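/- Let $F$ be the free group on two generators $x$ and $y$. Call $p\in F$ primitive if $p$ is the image of $x$ under some automorphism of $F$. For $w\in F$ let $w\Psi$ be the image of $w^{-1}$ under the automorphism of $F$ given by $x\mapsto x^{-1}$, $y\mapsto y^{-1}$ (so $w\Psi$ is $w$ read backwards), and call $w$ a palindrome if $w\Psi=w$; in particular the identity is a palindrome. Let $p$ be a primitive element of $F$. Then at least one of the following two statements holds: 1. $p=z^{-1}wz$ for some $z\in F$ and some palindrome $w\in F$; 2. $p=z^{-1}awz$ for some $z\in F$, some $a\in\{x,x^{-1},y,y^{-1}\}$ and some palindrome $w\in F$. -/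

import Mathlib

namespace RankTwo

/-- The free group `F(x, y)` on two generators. -/
abbrev F : Type := FreeGroup (Fin 2)

/-- The first free generator. -/
def x : F := FreeGroup.of 0

/-- The second free generator. -/
def y : F := FreeGroup.of 1

/-- The endomorphism `x ↦ x⁻¹`, `y ↦ y` of `F`. -/
def alphaX : F →* F := FreeGroup.lift ![x⁻¹, y]

/-- The endomorphism `x ↦ x`, `y ↦ y⁻¹` of `F`. -/
def alphaY : F →* F := FreeGroup.lift ![x, y⁻¹]

/-- The reversal map `w ↦ (w⁻¹) α_x α_y` of `F` (functions acting on the right): it inverts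
every letter of the inverse word, so it reads a word backwards. -/
def reversal (w : F) : F := alphaY (alphaX w⁻¹)

/-- An element of `F` is primitive if it is the image of `x` under some automorphism of `F`. -/
def IsPrimitive (p : F) : Prop := ∃ θ : F ≃* F, θ x = p

/-- An element of `F` is a palindrome if it reads the same forwards and backwards. -/
def IsPalindrome (w : F) : Prop := reversal w = w

end RankTwo

/-! Let `iota` invert both generators. Every generating pair `(p, q)` is inverted by `iota` up to
conjugation by a common `g` (`iotaInverted_of_closure_eq_top`). This property survives Nielsen moves
and conjugation, so a counterexample of least total length is so reduced that a reduced word of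
length `n` in `p, q` has norm at least `n`. Then `x` and `y` are themselves among `p`, `q` and their
inverses, where `g = 1` works: a contradiction. As `iota` is an involution, `iota g * g` is central,
hence trivial, and `g` is a palindrome; so is `g * p`. Splitting `g` at its middle writes `p = g⁻¹ *
(g * p)` in one of the two forms, according to the parity of the length of `g`. -/

namespace RankTwo

/-! ### Common prefixes and cancellation in free groups -/

section LengthFunction

variable {α : Type*} [DecidableEq α]

/-- The length of the longest common prefix of two lists. -/
def lcpLength {β : Type*} [DecidableEq β] : List β → List β → ℕ
  | a :: l, b :: m => if a = b then lcpLength l m + 1 else 0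
  | _, _ => 0

section lcpLength

variable {β : Type*} [DecidableEq β]

theorem lcpLength_comm (l m : List β) : lcpLength l m = lcpLength m l := by
  induction l generalizing m with
  | nil => cases m <;> simp [lcpLength]
  | cons a l ih =>
    cases m with
    | nil => simp [lcpLength]
    | cons b m => simp [lcpLength, ih m, eq_comm]

theorem lcpLength_le_left (l m : List β) : lcpLength l m ≤ l.length := by
  induction l generalizing m with
  | nil => cases m <;> simp [lcpLength]
  | cons a l ih =>
    cases m with
    | nil => simp [lcpLength]
    | cons b m =>
      have := ih m
      simp only [lcpLength, List.length_cons]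
      split <;> omega

/-- The ultrametric inequality for prefixes; with `norm_inv_mul_add` it reduces cancellation
arguments to linear arithmetic. -/
theorem min_lcpLength_le (l m n : List β) :
    min (lcpLength l m) (lcpLength m n) ≤ lcpLength l n := by
  induction l generalizing m n with
  | nil => cases m <;> simp [lcpLength]
  | cons a l ih =>
    cases m with
    | nil => simp [lcpLength]
    | cons b m =>
      cases n with
      | nil => simp [lcpLength]
      | cons c n =>
        have := ih m n
        simp only [lcpLength]
        split_ifs <;> first | omega | simp_all

theorem getElem?_eq_of_lt_lcpLength (l m : List β) (i : ℕ) (hi : i < lcpLength l m) :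
    l[i]? = m[i]? := by
  induction l generalizing m i with
  | nil => cases m <;> simp [lcpLength] at hi
  | cons a l ih =>
    cases m with
    | nil => simp [lcpLength] at hi
    | cons b m =>
      simp only [lcpLength] at hi
      split_ifs at hi with h
      · cases i with
        | zero => simp [h]
        | succ i => simpa using ih m i (by omega)
      · omega

theorem lcpLength_take (l : List β) (k : ℕ) (hk : k ≤ l.length) :
    lcpLength l (l.take k) = k := by
  induction l generalizing k with
  | nil => simp at hk; simp [lcpLength, hk]
  | cons a l ih =>
    cases k with
    | zero => simp [lcpLength]
    | succ k => simp [lcpLength, ih k (by simpa using hk)]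

end lcpLength

/-- The length of the longest common prefix of the reduced words of two elements. -/
def overlap (u v : FreeGroup α) : ℕ := lcpLength u.toWord v.toWord

theorem overlap_comm (u v : FreeGroup α) : overlap u v = overlap v u := lcpLength_comm _ _

theorem overlap_le_left (u v : FreeGroup α) : overlap u v ≤ u.norm := lcpLength_le_left _ _

theorem overlap_le_right (u v : FreeGroup α) : overlap u v ≤ v.norm :=
  overlap_comm u v ▸ overlap_le_left v u

theorem min_overlap_le (u v w : FreeGroup α) :
    min (overlap u v) (overlap v w) ≤ overlap u w := min_lcpLength_le _ _ _

theorem norm_mk_of_isReduced {l : List (α × Bool)} (h : FreeGroup.IsReduced l) :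
    (FreeGroup.mk l).norm = l.length := by
  rw [FreeGroup.norm, FreeGroup.toWord_mk, h.reduce_eq]

theorem norm_mk_inv_mul_mk (l m : List (α × Bool)) (hl : FreeGroup.IsReduced l)
    (hm : FreeGroup.IsReduced m) :
    ((FreeGroup.mk l)⁻¹ * FreeGroup.mk m).norm + 2 * lcpLength l m = l.length + m.length := by
  induction l generalizing m with
  | nil =>
    rw [← FreeGroup.one_eq_mk]
    simp [lcpLength, norm_mk_of_isReduced hm]
  | cons a l ih =>
    cases m with
    | nil =>
      rw [← FreeGroup.one_eq_mk, mul_one, FreeGroup.norm_inv_eq, norm_mk_of_isReduced hl]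
      simp [lcpLength]
    | cons b m =>
      by_cases hab : a = b
      · subst hab
        have h1 : ∀ l : List (α × Bool),
            FreeGroup.mk (a :: l) = FreeGroup.mk [a] * FreeGroup.mk l := fun l => by simp
        have := ih m hl.tail hm.tail
        rw [h1 l, h1 m, mul_inv_rev, mul_assoc, inv_mul_cancel_left]
        simp only [lcpLength, if_true, List.length_cons]
        omega
      · have hred : FreeGroup.IsReduced (FreeGroup.invRev (a :: l) ++ (b :: m)) := by
          have h2 : FreeGroup.IsReduced (FreeGroup.invRev (a :: l)) := by
            rw [FreeGroup.isReduced_iff_reduce_eq, FreeGroup.reduce_invRev, hl.reduce_eq]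
          refine List.IsChain.append h2 hm ?_
          intro c hc d hd
          simp only [FreeGroup.invRev, List.map_cons, List.reverse_cons,
            List.getLast?_append, List.getLast?_singleton, List.head?_cons] at hc hd
          simp at hc hd
          subst hc hd
          intro h
          rcases a with ⟨a, _ | _⟩ <;> rcases b with ⟨b, _ | _⟩ <;> simp_all
        rw [FreeGroup.inv_mk, FreeGroup.mul_mk, norm_mk_of_isReduced hred]
        simp [lcpLength, hab, FreeGroup.invRev_length]

theorem norm_inv_mul_add (u v : FreeGroup α) :
    (u⁻¹ * v).norm + 2 * overlap u v = u.norm + v.norm := by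
  have := norm_mk_inv_mul_mk u.toWord v.toWord FreeGroup.isReduced_toWord
    FreeGroup.isReduced_toWord
  rwa [FreeGroup.mk_toWord, FreeGroup.mk_toWord] at this

theorem norm_mul_add (u v : FreeGroup α) :
    (u * v).norm + 2 * overlap u⁻¹ v = u.norm + v.norm := by
  have := norm_inv_mul_add u⁻¹ v
  rwa [inv_inv, FreeGroup.norm_inv_eq] at this

theorem exists_prefix (u : FreeGroup α) (k : ℕ) (hk : k ≤ u.norm) :
    ∃ r : FreeGroup α, r.norm = k ∧ overlap u r = k := by
  have hr : FreeGroup.IsReduced (u.toWord.take k) :=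
    List.IsChain.infix FreeGroup.isReduced_toWord (List.take_prefix k _).isInfix
  refine ⟨FreeGroup.mk (u.toWord.take k), ?_, ?_⟩
  · rw [norm_mk_of_isReduced hr, List.length_take]
    exact min_eq_left hk
  · rw [overlap, FreeGroup.toWord_mk, hr.reduce_eq]
    exact lcpLength_take _ _ hk

/-- A nontrivial element cancels less than half of itself in its square. -/
theorem two_mul_overlap_inv_self_lt (u : FreeGroup α) (hu : u ≠ 1) :
    2 * overlap u⁻¹ u < u.norm := by
  by_contra! h
  have hpos : 0 < u.norm := Nat.pos_of_ne_zero fun h0 => hu (FreeGroup.norm_eq_zero.1 h0)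
  have key : ∀ i < overlap u⁻¹ u,
      u.toWord[i]? = (u.toWord[u.norm - 1 - i]?).map fun g => (g.1, !g.2) := by
    intro i hi
    have hle := overlap_le_right u⁻¹ u
    have := getElem?_eq_of_lt_lcpLength _ _ i hi
    rw [← this, FreeGroup.toWord_inv, FreeGroup.invRev, List.getElem?_reverse, List.length_map,
      List.getElem?_map]
    · rfl
    · simpa [FreeGroup.norm] using hi.trans_le hle
  have hred : FreeGroup.IsReduced u.toWord := FreeGroup.isReduced_toWord
  rcases Nat.even_or_odd' u.norm with ⟨k, hk | hk⟩
  -- Even length: the two middle letters would be adjacent inverses. Odd length: the middle letter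
  -- would be its own inverse.
  · have := key (k - 1) (by omega)
    rw [show u.norm - 1 - (k - 1) = k - 1 + 1 by omega] at this
    have hlt : k - 1 + 1 < u.toWord.length := by
      change _ < u.norm
      omega
    have hc := (List.isChain_iff_getElem.1 hred) (k - 1) hlt
    rw [List.getElem?_eq_getElem hlt, List.getElem?_eq_getElem (by omega)] at this
    simp only [Option.map_some, Option.some.injEq] at this
    rw [this] at hc
    simp at hc
  · have := key k (by omega)
    rw [show u.norm - 1 - k = k by omega] at this
    have hlt : k < u.toWord.length := by
      change _ < u.norm
      omega
    rw [List.getElem?_eq_getElem hlt] at this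
    simp only [Option.map_some, Option.some.injEq] at this
    have := congrArg Prod.snd this
    simp at this

/-- If half of `p` cancels in `p * q` and the other half in `q * p`, then conjugation by the
first half of `p` shortens the pair `(p, p * q)`. -/
theorem exists_conj_norm_le (p q : FreeGroup α) (h₁ : 2 * overlap p⁻¹ q = p.norm)
    (h₂ : 2 * overlap q⁻¹ p = p.norm) (h₃ : p.norm ≤ q.norm) :
    ∃ r : FreeGroup α, (r⁻¹ * p * r).norm ≤ p.norm ∧
      (r⁻¹ * (p * q) * r).norm + p.norm = q.norm := by
  have hpi : p⁻¹.norm = p.norm := FreeGroup.norm_inv_eq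
  have hqi : q⁻¹.norm = q.norm := FreeGroup.norm_inv_eq
  set k := overlap p⁻¹ q with hk
  obtain ⟨r, hr, hpr⟩ := exists_prefix p k (by omega)
  obtain ⟨s, hs, hps⟩ := exists_prefix p⁻¹ k (by omega)
  -- `p * s` has norm `k` and shares its first `k` letters with `p`, so it equals `r`.
  have hprs : p = r * s⁻¹ := by
    have e1 := norm_mul_add p s
    have e2 := norm_inv_mul_add p (p * s)
    rw [inv_mul_cancel_left] at e2
    have e3 := min_overlap_le r p (p * s)
    rw [overlap_comm r p] at e3
    have e4 := norm_inv_mul_add r (p * s)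
    have : (r⁻¹ * (p * s)).norm = 0 := by omega
    rw [FreeGroup.norm_eq_zero] at this
    rw [eq_mul_inv_iff_mul_eq]
    exact (inv_mul_eq_one.1 this).symm
  refine ⟨r, ?_, ?_⟩
  · rw [hprs, inv_mul_cancel_left, ← hprs]
    have := FreeGroup.norm_mul_le s⁻¹ r
    rw [FreeGroup.norm_inv_eq] at this
    omega
  · have e1 : r⁻¹ * (p * q) * r = (r⁻¹ * (q⁻¹ * s))⁻¹ := by rw [hprs]; group
    rw [e1, FreeGroup.norm_inv_eq]
    -- `q` begins with `s` and `q⁻¹` with `r`; since `2 * k ≤ q.norm` these pieces are disjoint, and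
    -- both cancel in `s⁻¹ * q * r`.
    have hsq : overlap q s ≥ k := by
      have := min_overlap_le q p⁻¹ s
      rw [overlap_comm q] at this
      omega
    have := overlap_le_right q s
    have e2 := norm_inv_mul_add q s
    have e3 := norm_inv_mul_add q⁻¹ (q⁻¹ * s)
    rw [inv_inv, mul_inv_cancel_left] at e3
    have e4 := min_overlap_le r q⁻¹ (q⁻¹ * s)
    have e5 := min_overlap_le q⁻¹ p r
    have e6 := norm_inv_mul_add r (q⁻¹ * s)
    rw [overlap_comm r q⁻¹] at e4
    have := overlap_le_left r (q⁻¹ * s)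
    omega

/-- A list of elements of a free group in which every letter survives in part after all
cancellations between neighbours has a product at least as long as the list. -/
theorem length_le_norm_prod {ι : Type*} (u : ι → FreeGroup α) (R : ι → ι → Prop)
    (h₀ : ∀ a, u a ≠ 1)
    (h₁ : ∀ a b, R a b → 2 * overlap (u a)⁻¹ (u b) ≤ (u b).norm)
    (h₁' : ∀ a b, R a b → 2 * overlap (u a)⁻¹ (u b) ≤ (u a).norm)
    (h₂ : ∀ a b d, R a b → R b d →
      overlap (u a)⁻¹ (u b) + overlap (u b)⁻¹ (u d) < (u b).norm)
    (l : List ι) (hl : l.IsChain R) : l.length ≤ (l.map u).prod.norm := by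
  have h0 : ∀ a, 0 < (u a).norm := fun a =>
    Nat.pos_of_ne_zero fun h => h₀ a (FreeGroup.norm_eq_zero.1 h)
  -- Strengthened induction: cancellation by `u a` reaches only into `u b`, and beyond it one letter
  -- per factor survives.
  have key : ∀ (l : List ι) (a b : ι), (a :: b :: l).IsChain R →
      overlap (u a)⁻¹ ((b :: l).map u).prod = overlap (u a)⁻¹ (u b) ∧
      overlap (u a)⁻¹ (u b) + l.length + 1 ≤ ((b :: l).map u).prod.norm := by
    intro l
    induction l with
    | nil =>
      intro a b h
      have hab : R a b := by simpa using h
      have := h₁ a b hab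
      have := h0 b
      simp only [List.map_cons, List.map_nil, List.prod_cons, List.prod_nil, mul_one, List.length_nil]
      refine ⟨trivial, by omega⟩
    | cons d l ih =>
      intro a b h
      rw [List.isChain_cons_cons] at h
      obtain ⟨hab, h⟩ := h
      obtain ⟨i1, i2⟩ := ih b d h
      have hbd : R b d := (List.isChain_cons_cons.1 h).1
      have e0 := h₂ a b d hab hbd
      rw [List.map_cons, List.prod_cons]
      set W := ((d :: l).map u).prod
      have e1 := norm_mul_add (u b) W
      have e2 := norm_inv_mul_add (u b) (u b * W)
      rw [inv_mul_cancel_left] at e2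
      have e3 := min_overlap_le (u a)⁻¹ (u b) (u b * W)
      have e4 := min_overlap_le (u a)⁻¹ (u b * W) (u b)
      rw [overlap_comm _ (u b)] at e4
      simp only [List.length_cons]
      constructor <;> omega
  match l, hl with
  | [], _ => simp
  | [a], _ => simpa using Nat.succ_le_of_lt (h0 a)
  | a :: b :: l, hl =>
    obtain ⟨i1, i2⟩ := key l a b hl
    have hab : R a b := (List.isChain_cons_cons.1 hl).1
    rw [List.map_cons, List.prod_cons]
    have e1 := norm_mul_add (u a) ((b :: l).map u).prod
    have := h₁' a b hab
    have := h0 a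
    simp only [List.length_cons]
    omega

end LengthFunction

/-! ### Reversal, palindromes and the centre -/

/-- The automorphism of `F` inverting both generators. -/
def iota : F →* F := alphaY.comp alphaX

theorem iota_x : iota x = x⁻¹ := by simp [iota, alphaX, alphaY, x]

theorem iota_y : iota y = y⁻¹ := by simp [iota, alphaX, alphaY, y]

theorem reversal_eq (w : F) : reversal w = iota w⁻¹ := rfl

theorem reversal_mul (u v : F) : reversal (u * v) = reversal v * reversal u := by
  simp [reversal_eq]

theorem reversal_inv (u : F) : reversal u⁻¹ = (reversal u)⁻¹ := by
  simp [reversal_eq]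

theorem reversal_mk (l : List (Fin 2 × Bool)) :
    reversal (FreeGroup.mk l) = FreeGroup.mk l.reverse := by
  induction l with
  | nil => simp [reversal_eq, ← FreeGroup.one_eq_mk]
  | cons a l ih =>
    have h1 : FreeGroup.mk (a :: l) = FreeGroup.mk [a] * FreeGroup.mk l := by simp
    have h2 : reversal (FreeGroup.mk [a]) = FreeGroup.mk [a] := by
      rcases a with ⟨a, b⟩
      fin_cases a <;> cases b <;> decide
    rw [h1, reversal_mul, ih, h2, FreeGroup.mul_mk, List.reverse_cons]

theorem reversal_reversal (w : F) : reversal (reversal w) = w := by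
  rw [← w.mk_toWord, reversal_mk, reversal_mk, List.reverse_reverse]

theorem iota_iota (w : F) : iota (iota w) = w := by
  simpa [reversal_eq] using reversal_reversal w

theorem mem_letters (a : Fin 2 × Bool) :
    FreeGroup.mk [a] ∈ ({x, x⁻¹, y, y⁻¹} : Set F) := by
  rcases a with ⟨a, b⟩
  fin_cases a <;> cases b <;> simp [x, y, FreeGroup.of, FreeGroup.invRev]

/-- A palindrome is a word times its reversal, possibly with one more letter in the middle. -/
theorem IsPalindrome.exists_eq {g : F} (hg : IsPalindrome g) :
    (∃ z, g = reversal z * z) ∨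
      ∃ z, ∃ a ∈ ({x, x⁻¹, y, y⁻¹} : Set F), g = reversal z * a * z := by
  have hl : ∀ l : List (Fin 2 × Bool), l.Palindrome →
      (∃ z, FreeGroup.mk l = reversal z * z) ∨
      ∃ z, ∃ a ∈ ({x, x⁻¹, y, y⁻¹} : Set F), FreeGroup.mk l = reversal z * a * z := by
    intro l h
    induction h with
    | nil => exact Or.inl ⟨1, by simp [reversal_eq, ← FreeGroup.one_eq_mk]⟩
    | singleton a => exact Or.inr ⟨1, _, mem_letters a, by simp [reversal_eq]⟩
    | cons_concat a h ih =>
      rename_i l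
      have e : FreeGroup.mk (a :: (l ++ [a])) =
          reversal (FreeGroup.mk [a]) * FreeGroup.mk l * FreeGroup.mk [a] := by
        rw [reversal_mk]
        simp
      rcases ih with ⟨z, hz⟩ | ⟨z, b, hb, hz⟩
      · exact Or.inl ⟨z * FreeGroup.mk [a], by rw [e, hz, reversal_mul]; group⟩
      · exact Or.inr ⟨z * FreeGroup.mk [a], b, hb, by rw [e, hz, reversal_mul]; group⟩
  have hrev : g.toWord.reverse = g.toWord := by
    have h1 : FreeGroup.IsReduced g.toWord.reverse := by
      rw [FreeGroup.IsReduced, List.isChain_reverse]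
      exact FreeGroup.isReduced_toWord.imp fun a b h e => (h e.symm).symm
    have h2 : FreeGroup.mk g.toWord.reverse = g := by
      rw [← reversal_mk, FreeGroup.mk_toWord]
      exact hg
    have := congrArg FreeGroup.toWord h2
    rwa [FreeGroup.toWord_mk, h1.reduce_eq] at this
  simpa only [FreeGroup.mk_toWord] using hl _ (List.Palindrome.of_reverse_eq hrev)

/-- The free group of rank two has trivial centre. -/
theorem eq_one_of_commute_all (c : F) (h : ∀ w, c * w = w * c) : c = 1 := by
  -- Take a generator other than the one in the first letter of `c`. Then `a * c = c * a` begins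
  -- with both `a` and `c`, forcing `c = 1`.
  have : ∃ a : F, a.norm = 1 ∧ overlap a c = 0 ∧ overlap a⁻¹ c = 0 := by
    rw [← c.mk_toWord]
    rcases hc : c.toWord with _ | ⟨⟨i, b⟩, l⟩
    · exact ⟨x, by decide, by decide, by decide⟩
    · have hr : FreeGroup.IsReduced ((i, b) :: l) := hc ▸ FreeGroup.isReduced_toWord
      have hi : i = 0 ∨ i = 1 := by omega
      rcases hi with rfl | rfl
      · refine ⟨y, by decide, ?_, ?_⟩ <;>
          rw [overlap, FreeGroup.toWord_mk, hr.reduce_eq] <;>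
          simp [y, lcpLength, FreeGroup.invRev]
      · refine ⟨x, by decide, ?_, ?_⟩ <;>
          rw [overlap, FreeGroup.toWord_mk, hr.reduce_eq] <;>
          simp [x, lcpLength, FreeGroup.invRev]
  obtain ⟨a, ha, h1, h2⟩ := this
  have e1 := norm_mul_add a c
  have e2 := norm_inv_mul_add c (c * a)
  have e3 := norm_inv_mul_add a (a * c)
  rw [inv_mul_cancel_left] at e2 e3
  rw [h a] at e2
  have e4 := min_overlap_le a (a * c) c
  rw [overlap_comm _ c] at e4
  rw [← FreeGroup.norm_eq_zero]
  omega

/-! ### Generating pairs inverted by `iota` up to conjugation -/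

/-- The pair `(p, q)` is inverted by the composite of `iota` with an inner automorphism. -/
def IotaInverted (p q : F) : Prop :=
  ∃ g : F, iota p = g * p⁻¹ * g⁻¹ ∧ iota q = g * q⁻¹ * g⁻¹

theorem IotaInverted.swap {p q : F} (h : IotaInverted p q) : IotaInverted q p :=
  let ⟨g, hp, hq⟩ := h
  ⟨g, hq, hp⟩

theorem IotaInverted.inv_left {p q : F} (h : IotaInverted p q) : IotaInverted p⁻¹ q :=
  let ⟨g, hp, hq⟩ := h
  ⟨g, by rw [map_inv, hp]; group, hq⟩

theorem IotaInverted.mul_left {p q : F} (h : IotaInverted p q) : IotaInverted (p * q) q :=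
  let ⟨g, hp, hq⟩ := h
  -- The extra `q` turns `q⁻¹ * p⁻¹` into `p⁻¹ * q⁻¹` and fixes `q⁻¹`.
  ⟨g * q, by rw [map_mul, hp, hq]; group, by rw [hq]; group⟩

theorem IotaInverted.conj {p q : F} (h : IotaInverted p q) (r : F) :
    IotaInverted (r⁻¹ * p * r) (r⁻¹ * q * r) :=
  let ⟨g, hp, hq⟩ := h
  ⟨iota r⁻¹ * g * r, by simp only [map_mul, hp, map_inv]; group,
    by simp only [map_mul, hq, map_inv]; group⟩

/-- A generating pair that is not inverted by any `iota` times an inner automorphism, although all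
shorter generating pairs are. -/
structure MinimalBadPair (n : ℕ) (p q : F) : Prop where
  closure_eq : Subgroup.closure {p, q} = ⊤
  not_inverted : ¬ IotaInverted p q
  norm_add : p.norm + q.norm = n
  of_lt : ∀ p' q' : F, p'.norm + q'.norm < n → Subgroup.closure {p', q'} = ⊤ →
    IotaInverted p' q'

theorem closure_pair_eq_top_of_mem {p q p' q' : F} (h : Subgroup.closure {p, q} = ⊤)
    (hp : p ∈ Subgroup.closure {p', q'}) (hq : q ∈ Subgroup.closure {p', q'}) :
    Subgroup.closure {p', q'} = ⊤ := by
  rw [eq_top_iff, ← h, Subgroup.closure_le]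
  rintro _ (rfl | rfl)
  exacts [hp, hq]

theorem mem_closure_left (p q : F) : p ∈ Subgroup.closure {p, q} :=
  Subgroup.subset_closure (by simp)

theorem mem_closure_right (p q : F) : q ∈ Subgroup.closure {p, q} :=
  Subgroup.subset_closure (by simp)

theorem closure_mul_left {p q : F} (h : Subgroup.closure {p, q} = ⊤) :
    Subgroup.closure {p * q, q} = ⊤ := by
  refine closure_pair_eq_top_of_mem h ?_ (mem_closure_right _ _)
  simpa using mul_mem (mem_closure_left (p * q) q) (inv_mem (mem_closure_right (p * q) q))

theorem closure_inv_left {p q : F} (h : Subgroup.closure {p, q} = ⊤) :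
    Subgroup.closure {p⁻¹, q} = ⊤ := by
  refine closure_pair_eq_top_of_mem h ?_ (mem_closure_right _ _)
  simpa using inv_mem (mem_closure_left p⁻¹ q)

theorem closure_conj {p q : F} (h : Subgroup.closure {p, q} = ⊤) (r : F) :
    Subgroup.closure {r⁻¹ * p * r, r⁻¹ * q * r} = ⊤ := by
  have h1 : ({r⁻¹ * p * r, r⁻¹ * q * r} : Set F) = (MulAut.conj r⁻¹).toMonoidHom '' {p, q} := by
    simp [Set.image_pair]
  rw [h1, ← MonoidHom.map_closure, h, ← MonoidHom.range_eq_map, MonoidHom.range_eq_top]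
  exact (MulAut.conj r⁻¹).surjective

theorem not_commute_of_closure_eq_top {p q : F} (h : Subgroup.closure {p, q} = ⊤) :
    p * q ≠ q * p := by
  intro hc
  have h1 : ∀ a ∈ Subgroup.closure {p, q}, ∀ b ∈ Subgroup.closure {p, q}, a * b = b * a := by
    have hcomm : ∀ a ∈ ({p, q} : Set F), ∀ b ∈ ({p, q} : Set F), a * b = b * a := by
      rintro a (rfl | rfl) b (rfl | rfl) <;> simp [hc]
    have := Subgroup.isMulCommutative_closure hcomm
    intro a ha b hb
    exact congrArg Subtype.val (mul_comm' (⟨a, ha⟩ : Subgroup.closure {p, q}) ⟨b, hb⟩)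
  have := h1 x (by simp [h]) y (by simp [h])
  revert this
  decide

/-! ### Nielsen reduction of a minimal counterexample -/

namespace MinimalBadPair

variable {n : ℕ} {p q : F}

theorem swap (h : MinimalBadPair n p q) : MinimalBadPair n q p where
  closure_eq := by rw [Set.pair_comm]; exact h.closure_eq
  not_inverted hi := h.not_inverted hi.swap
  norm_add := by rw [add_comm]; exact h.norm_add
  of_lt := h.of_lt

theorem inv_left (h : MinimalBadPair n p q) : MinimalBadPair n p⁻¹ q where
  closure_eq := closure_inv_left h.closure_eq
  not_inverted hi := h.not_inverted (by simpa using hi.inv_left)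
  norm_add := by rw [FreeGroup.norm_inv_eq]; exact h.norm_add
  of_lt := h.of_lt

theorem inv_right (h : MinimalBadPair n p q) : MinimalBadPair n p q⁻¹ := h.swap.inv_left.swap

theorem not_inverted_mul (h : MinimalBadPair n p q) : ¬ IotaInverted (p * q) q := fun hi =>
  h.not_inverted (by simpa using hi.swap.inv_left.swap.mul_left.swap.inv_left.swap)

theorem ne_one (h : MinimalBadPair n p q) : p ≠ 1 := fun hp =>
  not_commute_of_closure_eq_top h.closure_eq (by simp [hp])

/-- Otherwise `(p * q, q)` would be a shorter bad pair. -/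
theorem two_mul_overlap_le_right (h : MinimalBadPair n p q) :
    2 * overlap p⁻¹ q ≤ q.norm := by
  by_contra! hlt
  have e1 := norm_mul_add p q
  have e2 := h.norm_add
  exact h.not_inverted_mul (h.of_lt _ _ (by omega) (closure_mul_left h.closure_eq))

theorem two_mul_overlap_le_left (h : MinimalBadPair n p q) :
    2 * overlap p⁻¹ q ≤ p.norm := by
  have := h.swap.inv_left.inv_right.two_mul_overlap_le_right
  rwa [inv_inv, overlap_comm, FreeGroup.norm_inv_eq] at this

/-- Failure means that exactly half of `p` cancels on each side; `exists_conj_norm_le` then gives a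
conjugate of the bad pair `(p, p * q)` of total norm at most `q.norm < n`. -/
theorem overlap_add_overlap_lt (h : MinimalBadPair n p q) :
    overlap q⁻¹ p + overlap p⁻¹ q < p.norm := by
  have e1 := h.two_mul_overlap_le_left
  have e2 := h.two_mul_overlap_le_right
  have e3 := h.swap.two_mul_overlap_le_right
  by_contra! hlt
  obtain ⟨r, hr1, hr2⟩ := exists_conj_norm_le p q (by omega) (by omega) (by omega)
  have hpos : p.norm ≠ 0 := fun h0 => h.ne_one (FreeGroup.norm_eq_zero.1 h0)
  have e4 := h.norm_add
  have h1 : ¬ IotaInverted p (p * q) := fun hi =>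
    h.not_inverted (by simpa using hi.swap.inv_left.mul_left.inv_left.swap)
  have hcl : Subgroup.closure {p, p * q} = ⊤ := by
    refine closure_pair_eq_top_of_mem h.closure_eq (mem_closure_left _ _) ?_
    simpa using mul_mem (inv_mem (mem_closure_left p (p * q))) (mem_closure_right p (p * q))
  have := (h.of_lt _ _ (by omega) (closure_conj hcl r)).conj r⁻¹
  refine h1 ?_
  convert this using 1 <;> group

/-- The element of the pair, or inverse of one, named by a signed letter. -/
def letter (p q : F) (a : Fin 2 × Bool) : F := cond a.2 (![p, q] a.1) (![p, q] a.1)⁻¹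

theorem letter_letter (h : MinimalBadPair n p q) {a b : Fin 2 × Bool} (hab : a.1 ≠ b.1) :
    MinimalBadPair n (letter p q a) (letter p q b) := by
  rcases a with ⟨i, _ | _⟩ <;> rcases b with ⟨j, _ | _⟩ <;> fin_cases i <;> fin_cases j <;>
    first
    | exact absurd rfl hab
    | exact h
    | exact h.swap
    | exact h.inv_left
    | exact h.inv_right
    | exact h.inv_left.inv_right
    | exact h.swap.inv_left
    | exact h.swap.inv_right
    | exact h.swap.inv_left.inv_right

theorem length_le_norm (h : MinimalBadPair n p q) (l : List (Fin 2 × Bool))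
    (hl : FreeGroup.IsReduced l) : l.length ≤ (l.map (letter p q)).prod.norm := by
  have ne1 : ∀ a, letter p q a ≠ 1 := by
    rintro ⟨i, b⟩
    exact (h.letter_letter (a := (i, b)) (b := (i + 1, b)) (by simp)).ne_one
  have hself : ∀ a, 2 * overlap (letter p q a)⁻¹ (letter p q a) < (letter p q a).norm :=
    fun a => two_mul_overlap_inv_self_lt _ (ne1 a)
  have hle : ∀ a b : Fin 2 × Bool, (a.1 = b.1 → a.2 = b.2) →
      2 * overlap (letter p q a)⁻¹ (letter p q b) ≤ (letter p q b).norm ∧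
      2 * overlap (letter p q a)⁻¹ (letter p q b) ≤ (letter p q a).norm := by
    intro a b hab
    by_cases hi : a.1 = b.1
    · obtain rfl : a = b := Prod.ext hi (hab hi)
      exact ⟨(hself a).le, (hself a).le⟩
    · exact ⟨(h.letter_letter hi).two_mul_overlap_le_right,
        (h.letter_letter hi).two_mul_overlap_le_left⟩
  refine length_le_norm_prod (letter p q) _ ne1 (fun a b hab => (hle a b hab).1)
    (fun a b hab => (hle a b hab).2) ?_ l hl
  intro a b d hab hbd
  have e1 := (hle a b hab).1
  have e2 := (hle b d hbd).2
  by_cases hi : a.1 = b.1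
  · obtain rfl : a = b := Prod.ext hi (hab hi)
    have := hself a
    omega
  by_cases hj : b.1 = d.1
  · obtain rfl : b = d := Prod.ext hj (hbd hj)
    have := hself b
    omega
  have hk : d.1 = a.1 := by omega
  by_cases hs : d.2 = a.2
  · obtain rfl : d = a := Prod.ext hk hs
    exact (h.letter_letter hj).overlap_add_overlap_lt
  -- If both overlaps were half of `letter p q b`, the ultrametric inequality would make this
  -- element cancel half of itself in its square.
  · have hd : letter p q d = (letter p q a)⁻¹ := by
      rcases a with ⟨i, _ | _⟩ <;> rcases d with ⟨j, _ | _⟩ <;> simp_all [letter]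
    rw [hd] at e2 ⊢
    have := min_overlap_le (letter p q b)⁻¹ (letter p q a)⁻¹ (letter p q b)
    have := hself b
    omega

theorem exists_letter_eq (h : MinimalBadPair n p q) (w : F) (hw : w.norm = 1) :
    ∃ a, letter p q a = w := by
  have h1 : w ∈ (FreeGroup.lift ![p, q]).range := by
    have hr : Set.range ![p, q] = {p, q} := by
      ext
      simp [eq_comm, or_comm]
    simp [FreeGroup.range_lift_eq_closure, hr, h.closure_eq]
  obtain ⟨v, hv⟩ := h1
  rw [← v.mk_toWord, FreeGroup.lift_mk] at hv
  have hle := h.length_le_norm v.toWord FreeGroup.isReduced_toWord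
  change (v.toWord.map (letter p q)).prod = w at hv
  rw [hv, hw] at hle
  rcases hvw : v.toWord with _ | ⟨a, _ | ⟨b, l⟩⟩
  · rw [hvw] at hv
    rw [← hv] at hw
    simp at hw
  · exact ⟨a, by simpa [hvw] using hv⟩
  · simp [hvw] at hle

protected theorem false (h : MinimalBadPair n p q) : False := by
  obtain ⟨⟨i, b⟩, ha⟩ := h.exists_letter_eq x (by decide)
  obtain ⟨⟨j, c⟩, hb⟩ := h.exists_letter_eq y (by decide)
  have hij : i ≠ j := by
    rintro rfl
    refine absurd (show x * y = y * x from ?_) (by decide)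
    rw [← ha, ← hb]
    cases b <;> cases c <;> simp [letter]
  have := (h.letter_letter (a := (i, b)) (b := (j, c)) hij).not_inverted
  rw [ha, hb] at this
  exact this ⟨1, by simp [iota_x], by simp [iota_y]⟩

end MinimalBadPair

/-- Every generating pair of the free group of rank two is inverted by the composite of `iota`
with an inner automorphism. -/
theorem iotaInverted_of_closure_eq_top (p q : F) (h : Subgroup.closure {p, q} = ⊤) :
    IotaInverted p q := by
  induction hn : p.norm + q.norm using Nat.strong_induction_on generalizing p q with
  | _ n ih =>
    by_contra hni
    exact MinimalBadPair.false ⟨h, hni, hn, fun p' q' hlt hc => ih _ hlt p' q' hc rfl⟩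

/-! ### From inversion to palindromes -/

/-- If `iota` followed by conjugation by `g` inverts a generating pair, `g` is a palindrome. -/
theorem isPalindrome_of_inverts {p q g : F} (h : Subgroup.closure {p, q} = ⊤)
    (hp : iota p = g * p⁻¹ * g⁻¹) (hq : iota q = g * q⁻¹ * g⁻¹) : IsPalindrome g := by
  have key : ∀ u : F, iota u = g * u⁻¹ * g⁻¹ → Commute (iota g * g) u := by
    intro u hu
    have h1 : u = iota g * (iota u)⁻¹ * (iota g)⁻¹ := by
      simpa only [map_mul, map_inv, iota_iota] using congrArg iota hu
    rw [hu] at h1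
    rw [commute_iff_eq]
    nth_rw 2 [h1]
    group
  have hc : ∀ w, iota g * g * w = w * (iota g * g) := by
    intro w
    have hw : w ∈ Subgroup.closure {p, q} := by simp [h]
    have hle : Subgroup.closure {p, q} ≤ Subgroup.centralizer {iota g * g} := by
      rw [Subgroup.closure_le]
      rintro _ (rfl | rfl)
      · exact Subgroup.mem_centralizer_singleton_iff.2 (key _ hp).symm
      · exact Subgroup.mem_centralizer_singleton_iff.2 (key _ hq).symm
    exact (Subgroup.mem_centralizer_singleton_iff.1 (hle hw)).symm
  have := eq_one_of_commute_all _ hc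
  rw [IsPalindrome, reversal_eq, map_inv]
  exact inv_eq_of_mul_eq_one_right this

theorem closure_x_y : Subgroup.closure {x, y} = ⊤ := by
  rw [← FreeGroup.closure_range_of (Fin 2)]
  congr 1
  ext w
  simp [x, y, Fin.exists_fin_two, eq_comm]

end RankTwo

theorem mainTheorem8 (p : RankTwo.F) (hp : RankTwo.IsPrimitive p) :
    (∃ z w : RankTwo.F, RankTwo.IsPalindrome w ∧ p = z⁻¹ * w * z) ∨
    (∃ z a w : RankTwo.F,
      a ∈ ({RankTwo.x, RankTwo.x⁻¹, RankTwo.y, RankTwo.y⁻¹} : Set RankTwo.F) ∧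
      RankTwo.IsPalindrome w ∧ p = z⁻¹ * a * w * z) := by
  open RankTwo in
  obtain ⟨θ, rfl⟩ := hp
  have hcl : Subgroup.closure {θ x, θ y} = ⊤ := by
    rw [← Set.image_pair, ← MulEquiv.coe_toMonoidHom, ← MonoidHom.map_closure, closure_x_y,
      ← MonoidHom.range_eq_map, MonoidHom.range_eq_top]
    exact θ.surjective
  obtain ⟨g, hx, hy⟩ := iotaInverted_of_closure_eq_top _ _ hcl
  have hg := isPalindrome_of_inverts hcl hx hy
  set p := θ x
  have hgp : reversal (g * p) = g * p := by
    rw [reversal_mul, show reversal g = g from hg, reversal_eq, map_inv, hx]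
    group
  -- For `z` the second half of `g`, this is the palindrome `w` sought; a middle letter of `g`
  -- contributes `a⁻¹`.
  have hpal : ∀ z : F, IsPalindrome ((reversal z)⁻¹ * (g * p) * z⁻¹) := by
    intro z
    simp only [IsPalindrome, reversal_mul (_ * _) z⁻¹, reversal_mul _ (g * p), reversal_inv, hgp,
      reversal_reversal]
    group
  rcases hg.exists_eq with ⟨z, hz⟩ | ⟨z, a, ha, hz⟩
  · refine Or.inl ⟨z, _, hpal z, ?_⟩
    rw [hz]
    group
  · refine Or.inr ⟨z, a⁻¹, _, ?_, hpal z, ?_⟩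
    · rcases ha with rfl | rfl | rfl | rfl <;> simp
    · rw [hz]
      group
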